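/- Throughout, $M$ is a non-empty complete CAT(0) space: a complete geodesic metric space in which every geodesic triangle is no fatter than its comparison triangle in the Euclidean plane. Its visual boundary $M(\infty)$ is the set of geodesic rays $[0,\infty)\to M$ modulo the relation of staying at bounded distance from each other. $M$ is visible if for all $x\ne y$ in $M(\infty)$ there is a geodesic line $c:\mathbb R\to M$ with $c(-\infty)=x$ and $c(+\infty)=y$, and $M$ is semi-uniformly visible if it is visible and contains no infinite flat strip, i.e. no convex subset isometric to a product $U\times\mathbb R$ (with the $\ell^2$ product metric), where $U$ is an unbounded metric space. For a (bijective) isometry $\gamma$ of $M$ put $|\gamma|:=\inf_{p\in M} d(\gamma p,p)$. The isometry $\gamma$ is called elliptic if it has a fixed point in $M$; hyperbolic if there is a geodesic line $c:\mathbb R\to M$ such that $\gamma$ acts on $c(\mathbb R)$ by a non-trivial translation, i.e. for some $\tau\neq 0$ we have $\gamma(c(t))=c(t+\tau)$ for all $t\in\mathbb R$; and parabolic if it is neither elliptic nor hyperbolic. **Theorem.** Let $M$ be a complete semi-uniformly visible CAT(0) space and let $\gamma$ be an isometry of $M$. Then: 1. $\gamma$ is elliptic if and only if $\gamma$ has a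 fixed point in $M$; 2. $\gamma$ is hyperbolic if and only if $|\gamma|>0$; 3. $\gamma$ is parabolic if and only if $|\gamma|=0$ and $\gamma$ has no fixed point in $M$. -/

import Mathlib

open scoped NNReal

universe u

namespace CatZero

section Geodesics

variable {M : Type u} [MetricSpace M]

/-- `c`, restricted to `[0, dist a b]`, is a geodesic from `a` to `b` parametrized by arc length. -/
structure IsGeodesicPath (c : ℝ → M) (a b : M) : Prop where
  start : c 0 = a
  finish : c (dist a b) = b
  dist_eq : ∀ s ∈ Set.Icc 0 (dist a b), ∀ t ∈ Set.Icc 0 (dist a b), dist (c s) (c t) = |s - t|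

/-- `S` is (the image of) a geodesic segment `[a, b]`. -/
def IsGeodesicSegment (S : Set M) (a b : M) : Prop :=
  ∃ c : ℝ → M, IsGeodesicPath c a b ∧ S = c '' Set.Icc 0 (dist a b)

/-- A subset is (geodesically) convex if any two of its points are joined by a geodesic segment
of the ambient space, and every such segment is contained in the subset. -/
def IsGeodesicallyConvex (C : Set M) : Prop :=
  ∀ a ∈ C, ∀ b ∈ C,
    (∃ S, IsGeodesicSegment S a b) ∧ ∀ S, IsGeodesicSegment S a b → S ⊆ C

end Geodesics

/-- A CAT(0) space: a geodesic metric space in which, for every geodesic triangle `abc` with sides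
`ab`, `bc`, `ca`, every comparison triangle `a'b'c'` in the Euclidean plane, all points `p`, `q` on
the sides `ab`, `ca` and their comparison points `p'`, `q'`, one has `dist p q ≤ dist p' q'`. -/
structure IsCAT0 (M : Type u) [MetricSpace M] : Prop where
  geodesic : ∀ a b : M, ∃ S, IsGeodesicSegment S a b
  comparison : ∀ (a b c : M) (ab bc ca : Set M),
    IsGeodesicSegment ab a b → IsGeodesicSegment bc b c → IsGeodesicSegment ca c a →
    ∀ a' b' c' : EuclideanSpace ℝ (Fin 2),
      dist a' b' = dist a b → dist b' c' = dist b c → dist c' a' = dist c a →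
      ∀ p ∈ ab, ∀ q ∈ ca, ∀ p' ∈ segment ℝ a' b', ∀ q' ∈ segment ℝ c' a',
        dist a' p' = dist a p → dist a' q' = dist a q → dist p q ≤ dist p' q'

/-- A geodesic ray `[0, ∞) → M`. -/
structure GeodesicRay (M : Type u) [MetricSpace M] where
  toFun : ℝ≥0 → M
  isometry : Isometry toFun

/-- A geodesic line `(-∞, ∞) → M`. -/
structure GeodesicLine (M : Type u) [MetricSpace M] where
  toFun : ℝ → M
  isometry : Isometry toFun

section Boundary

variable {M : Type u} [MetricSpace M]

/-- Two geodesic rays are asymptotic if they stay at bounded distance from each other. -/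
def Asymptotic (c d : GeodesicRay M) : Prop :=
  ∃ K : ℝ, ∀ t : ℝ≥0, dist (c.toFun t) (d.toFun t) ≤ K

variable (M) in
/-- The equivalence relation of being asymptotic. -/
def asymptoticSetoid : Setoid (GeodesicRay M) where
  r := Asymptotic
  iseqv :=
    { refl := fun _ => ⟨0, fun _ => (dist_self _).le⟩
      symm := fun ⟨K, hK⟩ => ⟨K, fun t => (dist_comm _ _).trans_le (hK t)⟩
      trans := fun ⟨K, hK⟩ ⟨L, hL⟩ =>
        ⟨K + L, fun t => (dist_triangle _ _ _).trans (add_le_add (hK t) (hL t))⟩ }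

variable (M) in
/-- The visual boundary `M(∞)`: geodesic rays up to the asymptotic relation. -/
def VisualBoundary : Type u := Quotient (asymptoticSetoid M)

/-- The point `c(+∞)` of the visual boundary represented by a geodesic ray. -/
def GeodesicRay.endpoint (c : GeodesicRay M) : VisualBoundary M :=
  Quotient.mk (asymptoticSetoid M) c

/-- The ray `t ↦ c(t)`, `t ≥ 0`, of a geodesic line. -/
def GeodesicLine.posRay (c : GeodesicLine M) : GeodesicRay M where
  toFun t := c.toFun t
  isometry := c.isometry.comp isometry_subtype_coe

/-- The ray `t ↦ c(-t)`, `t ≥ 0`, of a geodesic line. -/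
def GeodesicLine.negRay (c : GeodesicLine M) : GeodesicRay M where
  toFun t := c.toFun (-(t : ℝ))
  isometry := c.isometry.comp ((IsometryEquiv.neg ℝ).isometry.comp isometry_subtype_coe)

end Boundary

/-- Visibility: any two distinct points of the visual boundary are the endpoints
`c(-∞)`, `c(+∞)` of some geodesic line `c`. -/
def IsVisible (M : Type u) [MetricSpace M] : Prop :=
  ∀ x y : VisualBoundary M, x ≠ y →
    ∃ c : GeodesicLine M, c.negRay.endpoint = x ∧ c.posRay.endpoint = y

/-- `M` has an infinite flat strip: it contains a convex subset isometric to the `ℓ²` product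
`U × ℝ` of an unbounded metric space `U` with the real line. (Such a `U` embeds isometrically into
`M` as `U × {0}`, so nothing is lost by taking it in the universe of `M`.) -/
def HasInfiniteFlatStrip (M : Type u) [MetricSpace M] : Prop :=
  ∃ (U : Type u) (_ : MetricSpace U) (f : WithLp 2 (U × ℝ) → M),
    ¬ Bornology.IsBounded (Set.univ : Set U) ∧ Isometry f ∧ IsGeodesicallyConvex (Set.range f)

/-- Semi-uniform visibility: visible, and without an infinite flat strip. -/
def IsSemiUniformlyVisible (M : Type u) [MetricSpace M] : Prop :=
  IsVisible M ∧ ¬ HasInfiniteFlatStrip M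

section Isometries

variable {M : Type u} [MetricSpace M]

/-- The translation length `|γ| = inf_p dist (γ p) p`. -/
noncomputable def translationLength (γ : M ≃ᵢ M) : ℝ := ⨅ p : M, dist (γ p) p

/-- `γ` is elliptic: it has a fixed point. -/
def IsElliptic (γ : M ≃ᵢ M) : Prop := (Function.fixedPoints γ).Nonempty

/-- `γ` is hyperbolic: it acts on the image of some geodesic line by a non-trivial translation. -/
def IsHyperbolic (γ : M ≃ᵢ M) : Prop :=
  ∃ (c : GeodesicLine M) (τ : ℝ), τ ≠ 0 ∧ ∀ t : ℝ, γ (c.toFun t) = c.toFun (t + τ)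

/-- `γ` is parabolic: it is neither elliptic nor hyperbolic. -/
def IsParabolic (γ : M ≃ᵢ M) : Prop := ¬ IsElliptic γ ∧ ¬ IsHyperbolic γ

end Isometries

end CatZero

/-! Only the second claim has content: the first holds by definition and the third follows from the
second.

Suppose |γ| > 0. Midpoints show that the escape rate L = lim d(p, γⁿp)/n is at least |γ|
(`le_lim_dist_iterate`). By the Karlsson–Margulis argument (`exists_ray_tracking`) the forward and
backward orbits of p each follow a geodesic ray with error o(n). The endpoints of the two rays are
fixed by γ, and they differ because d(γ⁻ᵏp, γᵏp) ≥ 2Lk. Visibility joins them by a line l, and γl is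
parallel to l.

By the flat strip theorem (`Parallel.exists_hasShift`) and the absence of holonomy
(`HasShift.eq_add`), the lines parallel to l form a convex product of a cross section with ℝ. As
there is no infinite flat strip, the cross section is bounded. It is also complete and satisfies the
CN inequality, so the isometry that γ induces on it has a fixed point
(`exists_fixedPoint_of_midpoints`). The line through that point is translated by γ, non-trivially
since |γ| > 0.

Conversely, translation by τ along an axis forces d(γp, p) ≥ |τ| for every p, by comparing orbits.
-/

namespace CatZero

/-! ### Plane Euclidean geometry for comparison triangles. -/

section Comparison

/-- Three lengths satisfying the triangle inequalities are the side lengths of a plane triangle. -/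
theorem exists_comparison_triangle {x y z : ℝ} (hx : 0 ≤ x) (hy : 0 ≤ y) (hz : 0 ≤ z)
    (hxyz : x ≤ y + z) (hyxz : y ≤ x + z) (hzxy : z ≤ x + y) :
    ∃ a b c : EuclideanSpace ℝ (Fin 2), dist a b = x ∧ dist b c = y ∧ dist c a = z := by
  -- `w` is the first coordinate of the third vertex, given by the law of cosines. If `x = 0` the
  -- equation leaves it free.
  obtain ⟨w, hw, hwz⟩ : ∃ w : ℝ, 2 * x * w = x ^ 2 + z ^ 2 - y ^ 2 ∧ w ^ 2 ≤ z ^ 2 := by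
    rcases hx.eq_or_lt with rfl | hx
    · have : y = z := le_antisymm (by linarith) (by linarith)
      exact ⟨0, by rw [this]; ring, by simpa using sq_nonneg z⟩
    · refine ⟨(x ^ 2 + z ^ 2 - y ^ 2) / (2 * x), by field_simp, ?_⟩
      rw [← sq_abs, ← sq_abs z, abs_of_nonneg hz]
      refine pow_le_pow_left₀ (abs_nonneg _) ?_ 2
      rw [abs_le, le_div_iff₀ (by positivity), div_le_iff₀ (by positivity)]
      constructor <;> nlinarith
  have hs : Real.sqrt (z ^ 2 - w ^ 2) ^ 2 = z ^ 2 - w ^ 2 := Real.sq_sqrt (by linarith)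
  refine ⟨!₂[0, 0], !₂[x, 0], !₂[w, Real.sqrt (z ^ 2 - w ^ 2)], ?_, ?_, ?_⟩ <;>
    simp only [EuclideanSpace.dist_eq, Fin.sum_univ_two, Real.dist_eq, sq_abs] <;>
    simp only [Matrix.cons_val_zero, Matrix.cons_val_one]
  · rw [show (0 - x) ^ 2 + ((0 : ℝ) - 0) ^ 2 = x ^ 2 by ring, Real.sqrt_sq hx]
  · rw [show (x - w) ^ 2 + (0 - Real.sqrt (z ^ 2 - w ^ 2)) ^ 2 = y ^ 2 by nlinarith,
      Real.sqrt_sq hy]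
  · rw [show (w - 0) ^ 2 + (Real.sqrt (z ^ 2 - w ^ 2) - 0) ^ 2 = z ^ 2 by nlinarith,
      Real.sqrt_sq hz]

/-- Stewart's theorem. -/
theorem dist_lineMap_sq {E : Type*} [NormedAddCommGroup E] [InnerProductSpace ℝ E]
    (a b c : E) (l : ℝ) :
    dist (AffineMap.lineMap a b l) c ^ 2 =
      (1 - l) * dist a c ^ 2 + l * dist b c ^ 2 - l * (1 - l) * dist a b ^ 2 := by
  have h1 : AffineMap.lineMap a b l - c = (1 - l) • (a - c) + l • (b - c) := by
    rw [AffineMap.lineMap_apply_module]; module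
  have h2 : a - b = (a - c) - (b - c) := by abel
  rw [dist_eq_norm, dist_eq_norm, dist_eq_norm, dist_eq_norm, h1, h2, norm_add_sq_real,
    norm_sub_sq_real (a - c), norm_smul, norm_smul, inner_smul_left, inner_smul_right, mul_pow, mul_pow]
  simp only [Real.norm_eq_abs, sq_abs, conj_trivial]
  ring

end Comparison

/-! ### The CN inequality and convexity of the metric. -/

section Basic

variable {M : Type u} [MetricSpace M]

/-- `z` divides a segment from `a` to `b` in the ratio `l : 1 - l`. -/
def Divides (z a b : M) (l : ℝ) : Prop :=
  dist a z = l * dist a b ∧ dist z b = (1 - l) * dist a b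

theorem Divides.symm {z a b : M} {l : ℝ} (h : Divides z a b l) : Divides z b a (1 - l) := by
  refine ⟨?_, ?_⟩
  · rw [dist_comm b z, h.2, dist_comm a b]
  · rw [dist_comm z a, h.1, dist_comm a b]; ring

theorem Divides.map {N : Type*} [MetricSpace N] {f : M → N} (hf : Isometry f) {z a b : M} {l : ℝ}
    (h : Divides z a b l) : Divides (f z) (f a) (f b) l := by
  simpa only [Divides, hf.dist_eq] using h

theorem IsGeodesicPath.divides {σ : ℝ → M} {a b : M} (h : IsGeodesicPath σ a b) {s : ℝ}
    (hs : s ∈ Set.Icc 0 (dist a b)) : Divides (σ s) a b (s / dist a b) := by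
  have h0 : (0 : ℝ) ∈ Set.Icc 0 (dist a b) := ⟨le_rfl, dist_nonneg⟩
  have h1 : dist a b ∈ Set.Icc 0 (dist a b) := ⟨dist_nonneg, le_rfl⟩
  have ha := h.dist_eq 0 h0 s hs
  have hb := h.dist_eq s hs _ h1
  rw [h.start, zero_sub, abs_neg, abs_of_nonneg hs.1] at ha
  rw [h.finish, abs_sub_comm, abs_of_nonneg (by linarith [hs.2])] at hb
  rcases (dist_nonneg (x := a) (y := b)).eq_or_lt with h' | h'
  · have : s = 0 := le_antisymm (h' ▸ hs.2) hs.1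
    rw [Divides, ha, hb, ← h', this]; simp
  · refine ⟨?_, ?_⟩
    · rw [ha]; field_simp
    · rw [hb]; field_simp

theorem Isometry.divides {c : ℝ → M} (hc : Isometry c) (s t : ℝ) {l : ℝ} (h0 : 0 ≤ l)
    (h1 : l ≤ 1) : Divides (c ((1 - l) * s + l * t)) (c s) (c t) l := by
  refine ⟨?_, ?_⟩ <;> rw [hc.dist_eq, hc.dist_eq, Real.dist_eq, Real.dist_eq]
  · rw [show s - ((1 - l) * s + l * t) = l * (s - t) by ring, abs_mul, abs_of_nonneg h0]
  · rw [show (1 - l) * s + l * t - t = (1 - l) * (s - t) by ring, abs_mul,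
      abs_of_nonneg (by linarith)]

/-- The Bruhat–Tits (CN) inequality for points of a geodesic. -/
theorem IsCAT0.exists_divides (hM : IsCAT0 M) (a b : M) {l : ℝ} (h0 : 0 ≤ l) (h1 : l ≤ 1) :
    ∃ z, Divides z a b l ∧ ∀ p, dist z p ^ 2 ≤
      (1 - l) * dist a p ^ 2 + l * dist b p ^ 2 - l * (1 - l) * dist a b ^ 2 := by
  obtain ⟨_, σ, hσ, rfl⟩ := hM.geodesic a b
  have hmem : l * dist a b ∈ Set.Icc 0 (dist a b) :=
    ⟨by positivity, mul_le_of_le_one_left dist_nonneg h1⟩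
  have hdiv : Divides (σ (l * dist a b)) a b l := by
    rcases (dist_nonneg (x := a) (y := b)).eq_or_lt with h' | h'
    · have := hσ.divides hmem
      rw [Divides, ← h'] at this ⊢
      simpa using this
    · have := hσ.divides hmem
      rwa [mul_div_cancel_right₀ _ h'.ne'] at this
  refine ⟨_, hdiv, fun p => ?_⟩
  obtain ⟨bc, hbc⟩ := hM.geodesic b p
  obtain ⟨_, τ, hτ, rfl⟩ := hM.geodesic p a
  obtain ⟨a', b', c', hab, hbc', hca⟩ := exists_comparison_triangle
    (dist_nonneg (x := a) (y := b)) (dist_nonneg (x := b) (y := p)) (dist_nonneg (x := p) (y := a))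
    (by linarith [dist_triangle a p b, dist_comm a p, dist_comm p b])
    (by linarith [dist_triangle b a p, dist_comm a p, dist_comm a b])
    (by linarith [dist_triangle p b a, dist_comm p b, dist_comm a b])
  -- Only the case where the second point is the vertex `p` is needed.
  have key := hM.comparison a b p _ bc _ ⟨σ, hσ, rfl⟩ hbc ⟨τ, hτ, rfl⟩ a' b' c' hab hbc' hca
    (σ (l * dist a b)) ⟨_, hmem, rfl⟩ p ⟨0, ⟨le_rfl, dist_nonneg⟩, hτ.start⟩
    (AffineMap.lineMap a' b' l) ?_ c' (left_mem_segment ℝ _ _) ?_ ?_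
  · refine (pow_le_pow_left₀ dist_nonneg key 2).trans_eq ?_
    rw [dist_lineMap_sq, hab, hbc', dist_comm a' c', hca, dist_comm p a]
  · rw [segment_eq_image_lineMap]
    exact ⟨l, ⟨h0, h1⟩, rfl⟩
  · rw [dist_left_lineMap, Real.norm_eq_abs, abs_of_nonneg h0, hab, hdiv.1]
  · rw [dist_comm, hca, dist_comm]

/-- The dividing point `w` with the CN inequality, tested against `z`, satisfies `dist w z ^ 2 ≤ 0`;
so the inequality passes to every dividing point. -/
theorem IsCAT0.cn (hM : IsCAT0 M) {a b z : M} {l : ℝ} (hz : Divides z a b l) (h0 : 0 ≤ l)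
    (h1 : l ≤ 1) (p : M) : dist z p ^ 2 ≤
      (1 - l) * dist a p ^ 2 + l * dist b p ^ 2 - l * (1 - l) * dist a b ^ 2 := by
  obtain ⟨w, hw, hcn⟩ := hM.exists_divides a b h0 h1
  have h := hcn z
  rw [hz.1, dist_comm b z, hz.2] at h
  have : dist w z ^ 2 ≤ 0 := h.trans_eq (by ring)
  have : w = z := dist_le_zero.1 (by nlinarith [dist_nonneg (x := w) (y := z)])
  exact this ▸ hcn p

theorem IsCAT0.divides_unique (hM : IsCAT0 M) {a b z w : M} {l : ℝ} (hz : Divides z a b l)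
    (hw : Divides w a b l) (h0 : 0 ≤ l) (h1 : l ≤ 1) : z = w := by
  have h := hM.cn hz h0 h1 w
  rw [hw.1, dist_comm b w, hw.2] at h
  have : dist z w ^ 2 ≤ 0 := h.trans_eq (by ring)
  exact dist_le_zero.1 (by nlinarith [dist_nonneg (x := z) (y := w)])

/-- Apply CN for `w` tested at `z`, then CN for `z` tested at `c`; all terms but `l ^ 2 * dist b c ^
2` cancel. -/
theorem IsCAT0.dist_le_of_common_start (hM : IsCAT0 M) {a b c z w : M} {l : ℝ}
    (hz : Divides z a b l) (hw : Divides w a c l) (h0 : 0 ≤ l) (h1 : l ≤ 1) :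
    dist z w ≤ l * dist b c := by
  have hzw := hM.cn hw h0 h1 z
  have hzc := hM.cn hz h0 h1 c
  rw [hz.1, dist_comm c z] at hzw
  refine abs_le_of_sq_le_sq' ?_ (by positivity) |>.2
  rw [dist_comm z w]
  nlinarith [mul_le_mul_of_nonneg_left hzc h0]

/-- Convexity of the distance function. -/
theorem IsCAT0.dist_divides_le (hM : IsCAT0 M) {a b a' b' z z' : M} {l : ℝ}
    (hz : Divides z a b l) (hz' : Divides z' a' b' l) (h0 : 0 ≤ l) (h1 : l ≤ 1) :
    dist z z' ≤ (1 - l) * dist a a' + l * dist b b' := by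
  obtain ⟨w, hw, -⟩ := hM.exists_divides a b' h0 h1
  have hzw := hM.dist_le_of_common_start hz hw h0 h1
  have hwz := hM.dist_le_of_common_start hw.symm hz'.symm (sub_nonneg.2 h1) (by linarith)
  linarith [dist_triangle z w z']

/-- Add CN for the midpoint `m` of `a`, `c`, tested at `b` and at `d`, and use (mb + md)² ≤ 2(mb² +
md²). -/
theorem IsCAT0.quadrilateral (hM : IsCAT0 M) (a b c d : M) :
    dist a c ^ 2 + dist b d ^ 2 ≤
      dist a b ^ 2 + dist b c ^ 2 + dist c d ^ 2 + dist a d ^ 2 := by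
  obtain ⟨m, -, hm⟩ := hM.exists_divides a c (l := 1 / 2) (by norm_num) (by norm_num)
  have hb := hm b
  have hd := hm d
  have htri := dist_triangle_left b d m
  rw [dist_comm c b] at hb
  nlinarith [sq_nonneg (dist m b - dist m d), dist_nonneg (x := b) (y := d)]

end Basic

/-! ### Bounded convex functions on the line. -/

section RealConvexity

/-- A convex function on `ℝ` which is bounded above is constant. -/
theorem eq_of_convex_of_le {f : ℝ → ℝ} {K : ℝ}
    (hf : ∀ s t l : ℝ, 0 ≤ l → l ≤ 1 → f ((1 - l) * s + l * t) ≤ (1 - l) * f s + l * f t)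
    (hK : ∀ t, f t ≤ K) (s t : ℝ) : f s = f t := by
  have key : ∀ s t, f s ≤ f t := by
    intro s t
    have hlim : Filter.Tendsto (fun n : ℕ => f t + (1 / ((n : ℝ) + 1)) * (K - f t)) Filter.atTop
        (nhds (f t + 0 * (K - f t))) :=
      (tendsto_one_div_add_atTop_nhds_zero_nat.mul_const _).const_add _
    rw [zero_mul, add_zero] at hlim
    refine ge_of_tendsto' hlim fun n => ?_
    have hn : (0 : ℝ) < (n : ℝ) + 1 := by positivity
    have hl1 : 1 / ((n : ℝ) + 1) ≤ 1 := by
      rw [div_le_one hn]; linarith [(Nat.cast_nonneg n : (0 : ℝ) ≤ n)]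
    have h := hf t (t + ((n : ℝ) + 1) * (s - t)) (1 / ((n : ℝ) + 1)) (by positivity) hl1
    have he : (1 - 1 / ((n : ℝ) + 1)) * t + 1 / ((n : ℝ) + 1) * (t + ((n : ℝ) + 1) * (s - t)) = s := by
      field_simp; ring
    rw [he] at h
    have := mul_le_mul_of_nonneg_left (hK (t + ((n : ℝ) + 1) * (s - t)))
      (by positivity : 0 ≤ 1 / ((n : ℝ) + 1))
    linarith
  exact le_antisymm (key s t) (key t s)

end RealConvexity

/-! ### Asymptotics that isolate Busemann-type shifts. -/

section Limits

theorem tendsto_sqrt_sub (b E : ℝ) :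
    Filter.Tendsto (fun T : ℝ => Real.sqrt ((T + b) ^ 2 + |E|) - T) Filter.atTop (nhds b) := by
  have hT : Filter.Tendsto (fun T : ℝ => T + b) Filter.atTop Filter.atTop :=
    Filter.tendsto_atTop_add_const_right _ _ Filter.tendsto_id
  have hup : Filter.Tendsto (fun T : ℝ => b + |E| / (T + b)) Filter.atTop (nhds (b + 0)) :=
    (hT.const_div_atTop _).const_add _
  rw [add_zero] at hup
  refine tendsto_of_tendsto_of_tendsto_of_le_of_le' tendsto_const_nhds hup ?_ ?_
  · filter_upwards with T
    have : T + b ≤ Real.sqrt ((T + b) ^ 2 + |E|) :=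
      Real.le_sqrt_of_sq_le (by linarith [abs_nonneg E])
    linarith
  · filter_upwards [hT.eventually_gt_atTop 0] with T hT
    have : Real.sqrt ((T + b) ^ 2 + |E|) ≤ T + b + |E| / (T + b) := by
      refine Real.sqrt_le_iff.2 ⟨by positivity, ?_⟩
      have : (T + b) * (|E| / (T + b)) = |E| := by field_simp
      nlinarith [sq_nonneg (|E| / (T + b)), abs_nonneg E]
    linarith

/-- Each root is `T + b + o(1)`: far along parallel lines the width of the strip stops mattering and
only the shift remains. -/
theorem nonneg_of_forall_sqrt {A b b' E E' : ℝ} (hE : 0 ≤ E) (hE' : 0 ≤ E')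
    (h : ∀ T : ℝ, 2 * T ≤ A + Real.sqrt ((T + b) ^ 2 + E) + Real.sqrt ((T + b') ^ 2 + E')) :
    0 ≤ A + b + b' := by
  have hlim := ((tendsto_sqrt_sub b E).const_add A).add (tendsto_sqrt_sub b' E')
  rw [abs_of_nonneg hE, abs_of_nonneg hE'] at hlim
  exact ge_of_tendsto' hlim fun T => by linarith [h T]

theorem eq_zero_of_forall_mul_le {a K : ℝ} (h : ∀ u : ℝ, u * a ≤ K) : a = 0 := by
  by_contra ha
  have := h ((K + 1) / a)
  rw [div_mul_cancel₀ _ ha] at this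
  linarith

end Limits

/-! ### Parallel lines: flat strips, shifts and holonomy. -/

section ParallelLines

variable {M : Type u} [MetricSpace M]

/-- Two parametrized lines at bounded distance from each other. -/
def Parallel (c d : ℝ → M) : Prop := ∃ K : ℝ, ∀ t, dist (c t) (d t) ≤ K

theorem Parallel.symm {c d : ℝ → M} (h : Parallel c d) : Parallel d c :=
  h.imp fun _ hK t => (dist_comm _ _).trans_le (hK t)

theorem Parallel.trans {c d e : ℝ → M} (h : Parallel c d) (h' : Parallel d e) : Parallel c e := by
  obtain ⟨K, hK⟩ := h
  obtain ⟨L, hL⟩ := h'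
  exact ⟨K + L, fun t => (dist_triangle _ _ _).trans (add_le_add (hK t) (hL t))⟩

/-- `c` and `d` bound a flat strip of squared width `E`, and `d (-k)` is the point nearest
to `c 0`. -/
def HasShift (c d : ℝ → M) (k E : ℝ) : Prop :=
  0 ≤ E ∧ ∀ s t, dist (c s) (d t) ^ 2 = (t - s + k) ^ 2 + E

theorem HasShift.symm {c d : ℝ → M} {k E : ℝ} (h : HasShift c d k E) : HasShift d c (-k) E :=
  ⟨h.1, fun s t => by rw [dist_comm, h.2]; ring⟩

theorem HasShift.dist_eq {c d : ℝ → M} {k E : ℝ} (h : HasShift c d k E) (s t : ℝ) :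
    dist (c s) (d t) = Real.sqrt ((t - s + k) ^ 2 + E) := by
  rw [← h.2, Real.sqrt_sq dist_nonneg]

theorem HasShift.parallel {c d : ℝ → M} {k E : ℝ} (h : HasShift c d k E) : Parallel c d :=
  ⟨Real.sqrt (k ^ 2 + E), fun t => by rw [h.dist_eq, sub_self, zero_add]⟩

theorem HasShift.comp_add {c d : ℝ → M} {k E : ℝ} (h : HasShift c d k E) (a b : ℝ) :
    HasShift (fun t => c (t + a)) (fun t => d (t + b)) (k - a + b) E :=
  ⟨h.1, fun s t => by rw [h.2]; ring⟩

theorem HasShift.map {N : Type*} [MetricSpace N] {f : M → N} (hf : Isometry f) {c d : ℝ → M}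
    {k E : ℝ} (h : HasShift c d k E) : HasShift (fun t => f (c t)) (fun t => f (d t)) k E :=
  ⟨h.1, fun s t => by rw [hf.dist_eq, h.2]⟩

theorem hasShift_self {c : ℝ → M} (hc : Isometry c) : HasShift c c 0 0 :=
  ⟨le_rfl, fun s t => by rw [hc.dist_eq, Real.dist_eq, sq_abs]; ring⟩

/-- The route from `c 0` to `e (2 * T)` through `d T` is no shorter than the direct one. Subtracting
`2 * T` and letting `T → ∞` leaves only the shifts. -/
theorem HasShift.le_add {c d e : ℝ → M} {k k' k'' E E' E'' : ℝ} (h : HasShift c d k E)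
    (h' : HasShift d e k' E') (h'' : HasShift c e k'' E'') : k'' ≤ k + k' := by
  have := nonneg_of_forall_sqrt (A := -k'') (b := k) (b' := k') h.1 h'.1 fun T => by
    have htri := dist_triangle (c 0) (d T) (e (2 * T))
    rw [h.dist_eq, h'.dist_eq, h''.dist_eq] at htri
    have : 2 * T - 0 + k'' ≤ Real.sqrt ((2 * T - 0 + k'') ^ 2 + E'') :=
      Real.le_sqrt_of_sq_le (by linarith [h''.1])
    rw [sub_zero T, show 2 * T - T = T by ring] at htri
    linarith
  linarith

/-- Projecting along three parallel lines has no holonomy. -/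
theorem HasShift.eq_add {c d e : ℝ → M} {k k' k'' E E' E'' : ℝ} (h : HasShift c d k E)
    (h' : HasShift d e k' E') (h'' : HasShift c e k'' E'') : k'' = k + k' :=
  le_antisymm (h.le_add h' h'') (by linarith [h''.le_add h'.symm h])

/-- As a function of `s` the left side is convex and bounded, hence constant. -/
theorem Parallel.dist_add (hM : IsCAT0 M) {c d : ℝ → M} (hc : Isometry c) (hd : Isometry d)
    (h : Parallel c d) (s u : ℝ) : dist (c s) (d (s + u)) = dist (c 0) (d u) := by
  obtain ⟨K, hK⟩ := h
  have := eq_of_convex_of_le (f := fun s => dist (c s) (d (s + u))) (K := K + |u|) ?_ ?_ s 0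
  · simpa using this
  · intro s t l h0 h1
    have h2 := Isometry.divides hd (s + u) (t + u) h0 h1
    rw [show (1 - l) * (s + u) + l * (t + u) = (1 - l) * s + l * t + u by ring] at h2
    exact hM.dist_divides_le (Isometry.divides hc s t h0 h1) h2 h0 h1
  · intro t
    have h2 : dist (d t) (d (t + u)) = |u| := by
      rw [hd.dist_eq, Real.dist_eq, sub_add_cancel_left, abs_neg]
    linarith [dist_triangle (c t) (d t) (d (t + u)), hK t]

/-- The flat strip theorem, in metric form. -/
theorem Parallel.exists_hasShift (hM : IsCAT0 M) {c d : ℝ → M} (hc : Isometry c) (hd : Isometry d)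
    (h : Parallel c d) : ∃ k E, HasShift c d k E := by
  set φ : ℝ → ℝ := fun u => dist (c 0) (d u) ^ 2 with hφ
  have hφst : ∀ s t, dist (c s) (d t) ^ 2 = φ (t - s) := fun s t => by
    rw [hφ]
    simp only
    rw [← h.dist_add hM hc hd s (t - s), add_sub_cancel]
  -- `≤` is the quadrilateral inequality for `c 0`, `c s`, `d (s + u)`, `d u`; `≥` is CN at the
  -- midpoint `d u`. So φ(u) − u² solves Jensen's equation and, being continuous, is affine.
  have hjensen : ∀ u s, φ (u + s) + φ (u - s) = 2 * φ u + 2 * s ^ 2 := by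
    intro u s
    have h1 := hM.quadrilateral (c 0) (c s) (d (s + u)) (d u)
    have h2 := hM.cn (Isometry.divides hd (u + s) (u - s) (l := 1 / 2) (by norm_num) (by norm_num))
      (by norm_num) (by norm_num) (c 0)
    rw [hφst, hφst, hφst, hφst, hc.dist_eq, hd.dist_eq, Real.dist_eq, Real.dist_eq, sq_abs,
      sq_abs] at h1
    rw [dist_comm, hφst, dist_comm, hφst, dist_comm, hφst, hd.dist_eq, Real.dist_eq, sq_abs] at h2
    rw [sub_zero, sub_zero, add_sub_cancel_left, add_comm s u] at h1
    rw [sub_zero, sub_zero, sub_zero, show (1 - 1 / 2) * (u + s) + 1 / 2 * (u - s) = u by ring] at h2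
    nlinarith
  have hcont : Continuous φ := (continuous_const.dist hd.continuous).pow 2
  let g : ℝ → ℝ := fun u => φ u - u ^ 2 - φ 0
  have hg : ∀ u s, g (u + s) + g (u - s) = 2 * g u := fun u s => by
    simp only [g]; linarith [hjensen u s]
  have hg0 : g 0 = 0 := by simp [g]
  let G : ℝ →+ ℝ :=
    { toFun := g
      map_zero' := hg0
      map_add' := fun x y => by
        have h1 := hg ((x + y) / 2) ((x - y) / 2)
        have h2 := hg ((x + y) / 2) ((x + y) / 2)
        rw [show (x + y) / 2 + (x - y) / 2 = x by ring,
          show (x + y) / 2 - (x - y) / 2 = y by ring] at h1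
        rw [sub_self, hg0, add_halves] at h2
        linarith }
  have hlin : ∀ u, g u = u * g 1 := fun u => by
    have := map_real_smul G (by exact (hcont.sub (continuous_id.pow 2)).sub continuous_const) u 1
    simpa [G] using this
  have hφu : ∀ u, φ u = (u + g 1 / 2) ^ 2 + (φ 0 - (g 1 / 2) ^ 2) := fun u => by
    have : φ u - u ^ 2 - φ 0 = u * g 1 := hlin u
    linarith
  refine ⟨g 1 / 2, φ 0 - (g 1 / 2) ^ 2, ?_, fun s t => by rw [hφst, hφu]⟩
  have h1 : 0 ≤ φ (-(g 1 / 2)) := sq_nonneg _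
  rw [hφu] at h1
  simpa using h1

/-- The points dividing corresponding points of two lines normal to `c` form again a line. -/
theorem exists_line_of_divides (hM : IsCAT0 M) {c x y : ℝ → M} (hc : Isometry c) (hx : Isometry x)
    (hy : Isometry y) {Ex Ey : ℝ} (hxc : HasShift x c 0 Ex) (hyc : HasShift y c 0 Ey)
    (s t : ℝ) {l : ℝ} (h0 : 0 ≤ l) (h1 : l ≤ 1) :
    ∃ m : ℝ → M, Isometry m ∧ (∀ r, Divides (m r) (x (s + r)) (y (t + r)) l) ∧
      ∃ E, HasShift m c (-((1 - l) * s + l * t)) E := by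
  obtain ⟨k, E, hxy⟩ := (hxc.parallel.trans hyc.parallel.symm).exists_hasShift hM hx hy
  obtain rfl : k = 0 := by simpa using hxc.eq_add hyc.symm hxy
  choose m hm _ using fun r => hM.exists_divides (x (s + r)) (y (t + r)) h0 h1
  set κ := (1 - l) * s + l * t with hκ
  set F := (1 - l) * Ex + l * Ey - l * (1 - l) * E with hF
  have hup : ∀ r T, dist (m r) (c T) ^ 2 ≤ (T - r - κ) ^ 2 + F := fun r T => by
    refine (hM.cn (hm r) h0 h1 (c T)).trans_eq ?_
    rw [hxc.2, hyc.2, hxy.2, hκ, hF]; ring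
  have hF0 : 0 ≤ F := by
    have := (sq_nonneg _).trans (hup 0 κ)
    simpa using this
  have hup' : ∀ r T, dist (m r) (c T) ≤ Real.sqrt ((T - r - κ) ^ 2 + F) := fun r T =>
    Real.le_sqrt_of_sq_le (hup r T)
  have hle : ∀ r r', r ≤ r' → dist (m r) (m r') = r' - r := by
    intro r r' hr
    refine le_antisymm ?_ ?_
    · have := hM.dist_divides_le (hm r) (hm r') h0 h1
      rw [hx.dist_eq, hy.dist_eq, Real.dist_eq, Real.dist_eq, add_sub_add_left_eq_sub,
        add_sub_add_left_eq_sub, abs_sub_comm, abs_of_nonneg (by linarith)] at this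
      linarith
    -- The route `c (-T)`, `m r`, `m r'`, `c T` has length at least `2 * T`; as `T → ∞` this bounds
    -- `dist (m r) (m r')` from below.
    · have := nonneg_of_forall_sqrt (A := dist (m r) (m r')) (b := r + κ) (b' := -r' - κ) hF0 hF0
        fun T => by
          have h2 := dist_triangle4 (c (-T)) (m r) (m r') (c T)
          have h3 := hup' r (-T)
          have h4 := hup' r' T
          rw [show (-T - r - κ) ^ 2 = (T + (r + κ)) ^ 2 by ring, dist_comm] at h3
          rw [show T - r' - κ = T + (-r' - κ) by ring] at h4
          rw [hc.dist_eq, Real.dist_eq] at h2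
          linarith [neg_le_abs (-T - T)]
      linarith
  have hmi : Isometry m := Isometry.of_dist_eq fun r r' => by
    rw [Real.dist_eq]
    rcases le_total r r' with h | h
    · rw [hle r r' h, abs_sub_comm, abs_of_nonneg (by linarith)]
    · rw [dist_comm, hle r' r h, abs_of_nonneg (by linarith)]
  have hpar : Parallel m c := ⟨Real.sqrt (κ ^ 2 + F), fun r => (hup' r r).trans_eq (by simp)⟩
  obtain ⟨k, E', hk⟩ := hpar.exists_hasShift hM hmi hc
  refine ⟨m, hmi, hm, E', ?_⟩
  -- One quadratic in `u` is bounded by another with the same leading term, so their linear terms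
  -- agree.
  have : 2 * (k + κ) = 0 := eq_zero_of_forall_mul_le (K := κ ^ 2 + F - k ^ 2 - E') fun u => by
    have := hup 0 u
    rw [hk.2] at this
    nlinarith
  rwa [show -κ = k by linarith]

end ParallelLines

/-! ### Fixed points through asymptotic centres. -/

section FixedPoint

/-- An isometric self-map of a bounded complete space with the CN inequality has a fixed point. -/
theorem exists_fixedPoint_of_midpoints {X : Type*} [MetricSpace X] [CompleteSpace X] [Nonempty X]
    {D : ℝ} (hD : ∀ x y : X, dist x y ≤ D)
    (hmid : ∀ x y : X, ∃ m : X, ∀ p,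
      dist m p ^ 2 ≤ (dist x p ^ 2 + dist y p ^ 2) / 2 - dist x y ^ 2 / 4)
    {T : X → X} (hT : Isometry T) : ∃ x, T x = x := by
  obtain ⟨o⟩ := ‹Nonempty X›
  -- `S z` holds the eventual bounds for the squared distance to the orbit of `o`, so `r z` below is
  -- a limsup. The fixed point will be its minimizer; `r (T z) ≤ r z` needs no surjectivity of `T`.
  let S : X → Set ℝ := fun z => {R | 0 ≤ R ∧ ∃ N : ℕ, ∀ n ≥ N, dist z (T^[n] o) ^ 2 ≤ R}
  have hSne : ∀ z, (S z).Nonempty := fun z =>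
    ⟨D ^ 2, sq_nonneg _, 0, fun n _ => pow_le_pow_left₀ dist_nonneg (hD _ _) 2⟩
  have hSbdd : ∀ z, BddBelow (S z) := fun z => ⟨0, fun R hR => hR.1⟩
  let r : X → ℝ := fun z => sInf (S z)
  have hr0 : ∀ z, 0 ≤ r z := fun z => Real.sInf_nonneg fun R hR => hR.1
  have hrT : ∀ z, r (T z) ≤ r z := fun z => by
    refine csInf_le_csInf (hSbdd _) (hSne z) ?_
    rintro R ⟨hR, N, hN⟩
    refine ⟨hR, N + 1, fun n hn => ?_⟩
    obtain ⟨n, rfl⟩ : ∃ k, n = k + 1 := ⟨n - 1, by omega⟩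
    rw [Function.iterate_succ_apply', hT.dist_eq]
    exact hN n (by omega)
  obtain ⟨ρ, hρ, hρ'⟩ : ∃ ρ, (∀ z, ρ ≤ r z) ∧ ∀ e > 0, ∃ z, r z < ρ + e := by
    refine ⟨sInf (Set.range r), fun z => csInf_le ⟨0, ?_⟩ ⟨z, rfl⟩, fun e he => ?_⟩
    · rintro _ ⟨w, rfl⟩; exact hr0 w
    · obtain ⟨_, ⟨z, rfl⟩, hz⟩ := Real.lt_sInf_add_pos (Set.range_nonempty r) he
      exact ⟨z, hz⟩
  -- Near-minimizers are close: otherwise CN would make `r` at their midpoint smaller than `ρ`.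
  have key : ∀ x y e, r x < ρ + e → r y < ρ + e → dist x y ^ 2 ≤ 4 * e := by
    intro x y e hx hy
    obtain ⟨R, ⟨hR0, N, hN⟩, hR⟩ := exists_lt_of_csInf_lt (hSne x) hx
    obtain ⟨R', ⟨hR0', N', hN'⟩, hR'⟩ := exists_lt_of_csInf_lt (hSne y) hy
    obtain ⟨m, hm⟩ := hmid x y
    have hmS : (R + R') / 2 - dist x y ^ 2 / 4 ∈ S m := by
      have h : ∀ n ≥ max N N', dist m (T^[n] o) ^ 2 ≤ (R + R') / 2 - dist x y ^ 2 / 4 :=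
        fun n hn => by
          linarith [hm (T^[n] o), hN n ((le_max_left _ _).trans hn),
            hN' n ((le_max_right _ _).trans hn)]
      exact ⟨(sq_nonneg _).trans (h _ le_rfl), _, h⟩
    have := (hρ m).trans (csInf_le (hSbdd m) hmS)
    linarith
  choose z hz using fun n : ℕ => hρ' (1 / ((n : ℝ) + 1)) (by positivity)
  have hlim : Filter.Tendsto (fun n : ℕ => Real.sqrt (4 * (1 / ((n : ℝ) + 1)))) Filter.atTop
      (nhds 0) := by
    have := ((tendsto_one_div_add_atTop_nhds_zero_nat (𝕜 := ℝ)).const_mul 4).sqrt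
    simpa using this
  have hcauchy : CauchySeq z := by
    refine cauchySeq_of_le_tendsto_0 _ (fun n m N hn hm => ?_) hlim
    refine Real.le_sqrt_of_sq_le (key _ _ _ ?_ ?_)
    · exact (hz n).trans_le (add_le_add_right (one_div_le_one_div_of_le (by positivity)
        (by gcongr)) _)
    · exact (hz m).trans_le (add_le_add_right (one_div_le_one_div_of_le (by positivity)
        (by gcongr)) _)
  obtain ⟨x, hx⟩ := cauchySeq_tendsto_of_complete hcauchy
  have h1 : Filter.Tendsto (fun n => dist (T (z n)) (z n)) Filter.atTop (nhds (dist (T x) x)) :=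
    ((hT.continuous.tendsto x).comp hx).dist hx
  have h2 : dist (T x) x ≤ 0 := le_of_tendsto_of_tendsto' h1 hlim fun n =>
    Real.le_sqrt_of_sq_le (key _ _ _ ((hrT _).trans_lt (hz n)) (hz n))
  exact ⟨x, dist_le_zero.1 h2⟩

end FixedPoint

/-! ### The product decomposition of the union of lines parallel to a given one. -/

section CrossSection

variable {M : Type u} [MetricSpace M]

/-- `d` is a line parallel to `c`, starting at `x`, whose nearest point on `c` is `c 0`. -/
structure IsNormalLine (c : ℝ → M) (x : M) (d : ℝ → M) : Prop where
  isometry : Isometry d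
  apply_zero : d 0 = x
  hasShift : ∃ E, HasShift d c 0 E

/-- The base points of the lines parallel to `c`: a cross section of the union of these lines. -/
def crossSection (c : ℝ → M) : Set M := {x | ∃ d, IsNormalLine c x d}

/-- The line parallel to `c` through a point of the cross section. -/
noncomputable def normalLine (c : ℝ → M) (x : crossSection c) : ℝ → M := x.2.choose

theorem isNormalLine_normalLine (c : ℝ → M) (x : crossSection c) :
    IsNormalLine c x (normalLine c x) := x.2.choose_spec

theorem isNormalLine_self {c : ℝ → M} (hc : Isometry c) : IsNormalLine c (c 0) c :=
  ⟨hc, rfl, 0, hasShift_self hc⟩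

/-- Absence of holonomy enters here: lines normal to `c` are also normal to each other, which makes
the union of parallels a metric product. -/
theorem IsNormalLine.hasShift_pair (hM : IsCAT0 M) {c d e : ℝ → M} {x y : M}
    (hd : IsNormalLine c x d) (he : IsNormalLine c y e) : HasShift d e 0 (dist x y ^ 2) := by
  obtain ⟨E, hE⟩ := hd.hasShift
  obtain ⟨E', hE'⟩ := he.hasShift
  obtain ⟨k, F, hF⟩ := (hE.parallel.trans hE'.parallel.symm).exists_hasShift hM hd.isometry
    he.isometry
  obtain rfl : k = 0 := by simpa using hE.eq_add hE'.symm hF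
  have := hF.2 0 0
  rw [hd.apply_zero, he.apply_zero] at this
  rw [this]
  simpa using hF

theorem IsNormalLine.dist_sq (hM : IsCAT0 M) {c d e : ℝ → M} {x y : M}
    (hd : IsNormalLine c x d) (he : IsNormalLine c y e) (s t : ℝ) :
    dist (d s) (e t) ^ 2 = dist x y ^ 2 + (s - t) ^ 2 := by
  rw [(hd.hasShift_pair hM he).2]; ring

theorem IsNormalLine.dist_eq (hM : IsCAT0 M) {c d e : ℝ → M} {x y : M}
    (hd : IsNormalLine c x d) (he : IsNormalLine c y e) (t : ℝ) :
    dist (d t) (e t) = dist x y := by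
  have := hd.dist_sq hM he t t
  rw [sub_self, zero_pow two_ne_zero, add_zero] at this
  exact (pow_left_inj₀ dist_nonneg dist_nonneg two_ne_zero).1 this

theorem IsNormalLine.unique (hM : IsCAT0 M) {c d e : ℝ → M} {x : M}
    (hd : IsNormalLine c x d) (he : IsNormalLine c x e) : d = e :=
  funext fun t => dist_le_zero.1 ((hd.dist_eq hM he t).trans (dist_self x)).le

theorem IsNormalLine.exists_of_divides (hM : IsCAT0 M) {c d e : ℝ → M} (hc : Isometry c) {x y z : M}
    (hd : IsNormalLine c x d) (he : IsNormalLine c y e) {s t l : ℝ}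
    (hz : Divides z (d s) (e t) l) (h0 : 0 ≤ l) (h1 : l ≤ 1) :
    ∃ w m, IsNormalLine c w m ∧ m ((1 - l) * s + l * t) = z := by
  obtain ⟨E, hE⟩ := hd.hasShift
  obtain ⟨E', hE'⟩ := he.hasShift
  obtain ⟨m, hm, hdiv, F, hF⟩ :=
    exists_line_of_divides hM hc hd.isometry he.isometry hE hE' s t h0 h1
  set κ := (1 - l) * s + l * t
  have h := hdiv 0
  rw [add_zero, add_zero] at h
  refine ⟨m (-κ), fun r => m (r + -κ), ⟨?_, by simp, F, ?_⟩, ?_⟩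
  · exact hm.comp (IsometryEquiv.addRight (-κ)).isometry
  · simpa using hF.comp_add (-κ) 0
  · simpa using hM.divides_unique h hz h0 h1

/-- The strip is swept out by the normal lines: `IsNormalLine.dist_sq` is the product metric and
`IsNormalLine.exists_of_divides` gives convexity. -/
theorem hasInfiniteFlatStrip_of_crossSection (hM : IsCAT0 M) {c : ℝ → M} (hc : Isometry c)
    (hU : ¬ Bornology.IsBounded (Set.univ : Set (crossSection c))) : HasInfiniteFlatStrip M := by
  refine ⟨crossSection c, inferInstance, fun p => normalLine c p.fst p.snd, hU, ?_, ?_⟩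
  · refine Isometry.of_dist_eq fun p q => ?_
    have h := (isNormalLine_normalLine c p.fst).dist_sq hM (isNormalLine_normalLine c q.fst)
      p.snd q.snd
    rw [WithLp.prod_dist_eq_add (by norm_num)]
    simp only [ENNReal.toReal_ofNat, Real.rpow_ofNat, Subtype.dist_eq, Real.dist_eq, sq_abs]
    rw [← h, ← Real.sqrt_eq_rpow, Real.sqrt_sq dist_nonneg]
  · rintro _ ⟨p, rfl⟩ _ ⟨q, rfl⟩
    refine ⟨hM.geodesic _ _, ?_⟩
    rintro _ ⟨σ, hσ, rfl⟩ _ ⟨s, hs, rfl⟩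
    obtain ⟨w, m, hm, hz⟩ := (isNormalLine_normalLine c p.fst).exists_of_divides hM hc
      (isNormalLine_normalLine c q.fst) (hσ.divides hs) (div_nonneg hs.1 dist_nonneg)
      (div_le_one_of_le₀ hs.2 dist_nonneg)
    exact ⟨WithLp.toLp 2 (⟨w, m, hm⟩, _),
      (congrFun ((isNormalLine_normalLine c ⟨w, m, hm⟩).unique hM hm) _).trans hz⟩

theorem isClosed_crossSection [CompleteSpace M] (hM : IsCAT0 M) {c : ℝ → M} (hc : Isometry c) :
    IsClosed (crossSection c) := by
  refine IsSeqClosed.isClosed fun x p hx hp => ?_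
  choose d hd using hx
  have hcauchy : ∀ t, CauchySeq fun n => d n t := fun t => by
    have := hp.cauchySeq
    rw [Metric.cauchySeq_iff] at this ⊢
    simpa only [(hd _).dist_eq hM (hd _)] using this
  choose e he using fun t => cauchySeq_tendsto_of_complete (hcauchy t)
  refine ⟨e, Isometry.of_dist_eq fun s t => ?_, ?_, dist p (c 0) ^ 2, sq_nonneg _, fun s t => ?_⟩
  · refine tendsto_nhds_unique ((he s).dist (he t)) ?_
    simp only [(hd _).isometry.dist_eq]
    exact tendsto_const_nhds
  · refine tendsto_nhds_unique (he 0) ?_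
    simpa only [(hd _).apply_zero] using hp
  · refine tendsto_nhds_unique (((he s).dist (tendsto_const_nhds (x := c t))).pow 2) ?_
    simp only [(hd _).dist_sq hM (isNormalLine_self hc)]
    rw [add_comm, add_zero, show (t - s) ^ 2 = (s - t) ^ 2 by ring]
    exact ((hp.dist tendsto_const_nhds).pow 2).add_const _

/-- An isometry mapping a line to a parallel one preserves a line parallel to it, if there is no
infinite flat strip. -/
theorem exists_invariant_line [CompleteSpace M] (hM : IsCAT0 M) (hflat : ¬ HasInfiniteFlatStrip M)
    {γ : M → M} (hγ : Isometry γ) {c : ℝ → M} (hc : Isometry c)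
    (hpar : Parallel (fun t => γ (c t)) c) :
    ∃ (d : ℝ → M) (τ : ℝ), Isometry d ∧ ∀ t, γ (d t) = d (t + τ) := by
  obtain ⟨κ, E₀, hκ⟩ := hpar.exists_hasShift hM (hγ.comp hc) hc
  -- The image under `γ` of any normal line has the same shift `κ` against `c`, so moving the
  -- parameter by `κ` makes it normal again. This induces the map `T` on the cross section.
  have hmove : ∀ {x d}, IsNormalLine c x d →
      IsNormalLine c (γ (d κ)) fun t => γ (d (t + κ)) := by
    intro x d hd
    obtain ⟨E, hE⟩ := hd.hasShift
    have h1 := hE.map hγ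
    obtain ⟨k, F, hF⟩ := (h1.parallel.trans hκ.parallel).exists_hasShift hM
      (hγ.comp hd.isometry) hc
    obtain rfl : k = κ := by simpa using h1.eq_add hκ hF
    exact ⟨hγ.comp (hd.isometry.comp (IsometryEquiv.addRight k).isometry), by simp, F,
      by simpa using hF.comp_add k 0⟩
  have hbdd : Bornology.IsBounded (Set.univ : Set (crossSection c)) :=
    not_not.1 fun h => hflat (hasInfiniteFlatStrip_of_crossSection hM hc h)
  obtain ⟨D, hD⟩ := Metric.isBounded_iff.1 hbdd
  have : CompleteSpace (crossSection c) := (isClosed_crossSection hM hc).completeSpace_coe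
  have : Nonempty (crossSection c) := ⟨⟨c 0, c, isNormalLine_self hc⟩⟩
  let T : crossSection c → crossSection c := fun x =>
    ⟨γ (normalLine c x κ), _, hmove (isNormalLine_normalLine c x)⟩
  have hT : Isometry T := Isometry.of_dist_eq fun x y => by
    rw [Subtype.dist_eq, hγ.dist_eq]
    exact (isNormalLine_normalLine c x).dist_eq hM (isNormalLine_normalLine c y) κ
  have hmid : ∀ x y : crossSection c, ∃ m : crossSection c, ∀ p,
      dist m p ^ 2 ≤ (dist x p ^ 2 + dist y p ^ 2) / 2 - dist x y ^ 2 / 4 := fun x y => by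
    obtain ⟨z, hz, hcn⟩ := hM.exists_divides (normalLine c x 0) (normalLine c y 0)
      (l := 1 / 2) (by norm_num) (by norm_num)
    obtain ⟨w, m, hm, hmz⟩ := (isNormalLine_normalLine c x).exists_of_divides hM hc
      (isNormalLine_normalLine c y) hz (by norm_num) (by norm_num)
    refine ⟨⟨w, m, hm⟩, fun p => ?_⟩
    rw [mul_zero, mul_zero, add_zero, hm.apply_zero] at hmz
    have := hcn p
    rw [(isNormalLine_normalLine c x).apply_zero, (isNormalLine_normalLine c y).apply_zero,
      ← hmz] at this
    simp only [Subtype.dist_eq]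
    linarith
  obtain ⟨x, hx⟩ := exists_fixedPoint_of_midpoints
    (fun x y => hD (Set.mem_univ x) (Set.mem_univ y)) hmid hT
  have hd := isNormalLine_normalLine c x
  have hx' : γ (normalLine c x κ) = x := congrArg Subtype.val hx
  have huniq := (hx' ▸ hmove hd).unique hM hd
  refine ⟨normalLine c x, -κ, hd.isometry, fun t => ?_⟩
  have := congrFun huniq (t + -κ)
  simpa using this

end CrossSection

/-! ### Sublinear tracking of a geodesic ray (Karlsson–Margulis). -/

section SublinearTracking

variable {M : Type u} [MetricSpace M]

theorem IsGeodesicPath.divides_start {σ : ℝ → M} {a b : M} (h : IsGeodesicPath σ a b) {s t : ℝ}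
    (hs : 0 ≤ s) (hst : s ≤ t) (ht0 : 0 < t) (ht : t ≤ dist a b) :
    Divides (σ s) a (σ t) (s / t) := by
  have h0 : (0 : ℝ) ∈ Set.Icc 0 (dist a b) := ⟨le_rfl, dist_nonneg⟩
  have hs' : s ∈ Set.Icc 0 (dist a b) := ⟨hs, hst.trans ht⟩
  have ht' : t ∈ Set.Icc 0 (dist a b) := ⟨ht0.le, ht⟩
  have h1 : dist a (σ t) = t := by
    rw [← h.start, h.dist_eq 0 h0 t ht', zero_sub, abs_neg, abs_of_pos ht0]
  have h2 : dist a (σ s) = s := by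
    rw [← h.start, h.dist_eq 0 h0 s hs', zero_sub, abs_neg, abs_of_nonneg hs]
  have h3 : dist (σ s) (σ t) = t - s := by
    rw [h.dist_eq s hs' t ht', abs_sub_comm, abs_of_nonneg (by linarith)]
  refine ⟨?_, ?_⟩
  · rw [h1, h2]; field_simp
  · rw [h1, h3]; field_simp

theorem GeodesicRay.divides (c : GeodesicRay M) {s t : ℝ≥0} (hst : s ≤ t) (ht : 0 < t) :
    Divides (c.toFun s) (c.toFun 0) (c.toFun t) (s / t) := by
  have ht' : (0 : ℝ) < t := ht
  have hst' : (s : ℝ) ≤ t := hst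
  refine ⟨?_, ?_⟩ <;> simp only [c.isometry.dist_eq, NNReal.dist_eq, NNReal.coe_zero, zero_sub,
    abs_neg, NNReal.abs_eq]
  · field_simp
  · rw [abs_sub_comm, abs_of_nonneg (by linarith)]; field_simp

/-- Rays diverging sublinearly are asymptotic. -/
theorem asymptotic_of_tendsto (hM : IsCAT0 M) {c d : GeodesicRay M} {L : ℝ≥0} (hL : 0 < L)
    (h : Filter.Tendsto (fun k : ℕ => dist (c.toFun (L * k)) (d.toFun (L * k)) / k) Filter.atTop
      (nhds 0)) : Asymptotic c d := by
  refine ⟨dist (c.toFun 0) (d.toFun 0), fun t => ?_⟩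
  -- By convexity the distance at time `t` is at most the initial one plus `t / (L * k)` times the
  -- distance at time `L * k`, and that term tends to 0.
  have hlim := (h.const_mul ((t : ℝ) / L)).const_add (dist (c.toFun 0) (d.toFun 0))
  rw [mul_zero, add_zero] at hlim
  refine ge_of_tendsto hlim ?_
  have hkt : Filter.Tendsto (fun k : ℕ => (L : ℝ) * k) Filter.atTop Filter.atTop :=
    tendsto_natCast_atTop_atTop.const_mul_atTop (NNReal.coe_pos.2 hL)
  filter_upwards [hkt.eventually_ge_atTop t, Filter.eventually_gt_atTop 0] with k hk hk0
  have hk0' : (0 : ℝ) < k := Nat.cast_pos.2 hk0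
  have hL' : (0 : ℝ) < L := hL
  have hle : t ≤ L * k := by exact_mod_cast hk
  have hpos : 0 < L * (k : ℝ≥0) := mul_pos hL (Nat.cast_pos.2 hk0)
  have h0 : 0 ≤ (t : ℝ) / (L * k : ℝ≥0) := by positivity
  have h1 : (t : ℝ) / (L * k : ℝ≥0) ≤ 1 := div_le_one_of_le₀ (by exact_mod_cast hle) (by positivity)
  refine (hM.dist_divides_le (c.divides hle hpos) (d.divides hle hpos) h0 h1).trans ?_
  have : (t : ℝ) / (L * k : ℝ≥0) * dist (c.toFun (L * k)) (d.toFun (L * k)) =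
      t / L * (dist (c.toFun (L * k)) (d.toFun (L * k)) / k) := by
    push_cast; field_simp
  rw [this]
  have := mul_nonneg h0 (dist_nonneg (x := c.toFun 0) (y := d.toFun 0))
  linarith

/-- A time up to which the sequence `a` has increased at speed at least `L - e`, seen from `n`. -/
def IsRecord (a : ℕ → ℝ) (L e : ℝ) (n : ℕ) : Prop := ∀ k ≤ n, a (n - k) ≤ a n - (L - e) * k

theorem IsRecord.mono {a : ℕ → ℝ} {L e e' : ℝ} {n : ℕ} (h : IsRecord a L e n) (he : e ≤ e') :
    IsRecord a L e' n := fun k hk => (h k hk).trans (by gcongr)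

/-- `a n - (L - e) * n` tends to infinity, so it exceeds all its earlier values at arbitrarily late
times. -/
theorem exists_isRecord {a : ℕ → ℝ} {L : ℝ} (ha : ∀ n : ℕ, L * n ≤ a n) {e : ℝ} (he : 0 < e)
    (N : ℕ) : ∃ n ≥ N, IsRecord a L e n := by
  have hu : Filter.Tendsto (fun n : ℕ => a n - (L - e) * n) Filter.atTop Filter.atTop := by
    refine Filter.tendsto_atTop_mono (fun n => ?_)
      (tendsto_natCast_atTop_atTop.const_mul_atTop he)
    linarith [ha n]
  obtain ⟨n, hn, hmax⟩ := Filter.high_scores hu N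
  refine ⟨n, hn, fun k hk => ?_⟩
  rcases Nat.eq_zero_or_pos k with rfl | hk0
  · simp
  · have := hmax (n - k) (by omega)
    simp only [Nat.cast_sub hk] at this
    linarith

variable {x : ℕ → M} {a : ℕ → ℝ} {L : ℝ≥0}

/-- At a record `n` the triangle `x 0`, `x k`, `x n` is nearly degenerate: its sides at `x k` are at
most `(L + e) * k` and `a n - (L - e) * k`. CN then puts `x k` near the point at distance `L * k`
from `x 0` on the third side. -/
theorem dist_geodesic_le_of_isRecord (hM : IsCAT0 M) (hL : 0 < L)
    (hx : ∀ m n, dist (x m) (x (m + n)) = a n) (ha : ∀ n : ℕ, L * n ≤ a n)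
    (hlim : Filter.Tendsto (fun n : ℕ => a n / n) Filter.atTop (nhds L)) {η : ℝ} (hη : 0 < η) :
    ∃ e > 0, ∃ K, ∀ k ≥ K, ∀ n ≥ k, IsRecord a L e n → ∀ z,
      Divides z (x 0) (x n) (L * k / a n) → dist (x k) z ≤ η * k := by
  have hL' : (0 : ℝ) < L := hL
  -- The squared error will be at most `(4 * L * e + e ^ 2) * k ^ 2`, which is at most `5 * L * e *
  -- k ^ 2` since `e ≤ L`.
  set e : ℝ := min L (η ^ 2 / (6 * L)) with he
  have he0 : 0 < e := lt_min hL' (by positivity)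
  have heL : e ≤ L := min_le_left _ _
  have heη : 6 * L * e ≤ η ^ 2 := by
    have := min_le_right (L : ℝ) (η ^ 2 / (6 * L))
    rw [← he, le_div_iff₀ (by positivity)] at this
    linarith
  obtain ⟨K, hK⟩ := Filter.eventually_atTop.1
    (hlim.eventually_le_const (show (L : ℝ) < L + e by linarith))
  refine ⟨e, he0, max K 1, fun k hk n hn hrec z hz => ?_⟩
  have hk0 : (0 : ℝ) < k := Nat.cast_pos.2 ((le_max_right _ _).trans hk)
  have hkn : (k : ℝ) ≤ n := Nat.cast_le.2 hn
  have hak := hK k ((le_max_left _ _).trans hk)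
  rw [div_le_iff₀ hk0] at hak
  have hc : 0 < a n := lt_of_lt_of_le (by positivity) ((mul_le_mul_of_nonneg_left hkn hL'.le).trans (ha n))
  have hlc : L * k / a n * a n = L * k := div_mul_cancel₀ _ hc.ne'
  have hl0 : 0 ≤ L * k / a n := by positivity
  have hl1 : L * k / a n ≤ 1 :=
    div_le_one_of_le₀ ((mul_le_mul_of_nonneg_left hkn hL'.le).trans (ha n)) hc.le
  set l := L * k / a n
  have hcn := hM.cn hz hl0 hl1 (x k)
  have h0k : dist (x 0) (x k) = a k := by simpa using hx 0 k
  have h0n : dist (x 0) (x n) = a n := by simpa using hx 0 n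
  have hnk : dist (x n) (x k) = a (n - k) := by
    rw [dist_comm, ← hx k (n - k), Nat.add_sub_cancel' hn]
  rw [h0k, h0n, hnk] at hcn
  have hb0 : 0 ≤ a (n - k) := hnk ▸ dist_nonneg
  have hak0 : 0 ≤ a k := h0k ▸ dist_nonneg
  have hb : a (n - k) ≤ (1 - l) * a n + e * k := by linarith [hrec k hn]
  have hb2 := mul_le_mul_of_nonneg_left (pow_le_pow_left₀ hb0 hb 2) hl0
  have ha2 := mul_le_mul_of_nonneg_left (pow_le_pow_left₀ hak0 hak 2) (sub_nonneg.2 hl1)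
  have hexp : (1 - l) * ((L + e) * k) ^ 2 + l * ((1 - l) * a n + e * k) ^ 2
      - l * (1 - l) * a n ^ 2 =
      (1 - l) * (4 * L * e + e ^ 2) * k ^ 2 + l * e ^ 2 * k ^ 2 := by
    linear_combination (-(1 - l) * (l * a n + L * k) + 2 * (1 - l) * e * k) * hlc
  have hfin : (1 - l) * (4 * L * e + e ^ 2) + l * e ^ 2 ≤ η ^ 2 := by
    nlinarith [mul_nonneg hl0 (mul_pos hL' he0).le]
  rw [dist_comm]
  refine abs_le_of_sq_le_sq' ?_ (by positivity) |>.2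
  nlinarith [mul_le_mul_of_nonneg_right hfin (sq_nonneg (k : ℝ))]

/-- The Karlsson–Margulis theorem, for a sequence with stationary distances: it tracks a geodesic
ray up to a sublinear error. -/
theorem exists_ray_tracking [CompleteSpace M] (hM : IsCAT0 M) (hL : 0 < L)
    (hx : ∀ m n, dist (x m) (x (m + n)) = a n) (ha : ∀ n : ℕ, L * n ≤ a n)
    (hlim : Filter.Tendsto (fun n : ℕ => a n / n) Filter.atTop (nhds L)) :
    ∃ c : GeodesicRay M,
      Filter.Tendsto (fun k : ℕ => dist (x k) (c.toFun (L * k)) / k) Filter.atTop (nhds 0) := by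
  have hL' : (0 : ℝ) < L := hL
  choose n hn hrec using fun i : ℕ => exists_isRecord ha (e := 1 / ((i : ℝ) + 1)) (by positivity) i
  choose S hS using fun i => hM.geodesic (x 0) (x (n i))
  choose σ hσ _ using hS
  have h0n : ∀ i, dist (x 0) (x (n i)) = a (n i) := fun i => by simpa using hx 0 (n i)
  have hlarge : ∀ k : ℕ, ∀ i ≥ k, L * k ≤ dist (x 0) (x (n i)) := fun k i hi => by
    rw [h0n]
    refine le_trans ?_ (ha _)
    gcongr
    exact hi.trans (hn i)
  have hnear : ∀ η > 0, ∃ K, ∀ k ≥ K, ∃ I, ∀ i ≥ I, dist (x k) (σ i (L * k)) ≤ η * k := by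
    intro η hη
    obtain ⟨e, he, K, hK⟩ := dist_geodesic_le_of_isRecord hM hL hx ha hlim hη
    obtain ⟨I, hI⟩ := exists_nat_one_div_lt he
    refine ⟨K, fun k hk => ⟨max I k, fun i hi => hK k hk (n i)
      (((le_max_right _ _).trans hi).trans (hn i)) ((hrec i).mono ?_) _ ?_⟩⟩
    · refine le_trans ?_ hI.le
      refine one_div_le_one_div_of_le (by positivity) ?_
      gcongr
      exact (le_max_left _ _).trans hi
    · rw [← h0n]
      exact (hσ i).divides ⟨by positivity, hlarge k i ((le_max_right _ _).trans hi)⟩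
  have hevent : ∀ t : ℝ≥0, ∀ᶠ i in Filter.atTop, (t : ℝ) ∈ Set.Icc 0 (dist (x 0) (x (n i))) := by
    intro t
    obtain ⟨k, hk⟩ := exists_nat_ge ((t : ℝ) / L)
    rw [div_le_iff₀ hL'] at hk
    filter_upwards [Filter.eventually_ge_atTop k] with i hi
    exact ⟨t.2, by linarith [hlarge k i hi]⟩
  have hcauchy : ∀ t : ℝ≥0, CauchySeq fun i => σ i t := by
    intro t
    rw [Metric.cauchySeq_iff]
    intro e he
    -- With tolerance η, geodesics `2 * η * k` apart at time `L * k` are at most `2 * η * t / L`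
    -- apart at time `t`. This η makes that less than `e`; the `+ 1` covers `t = 0`.
    obtain ⟨K, hK⟩ := hnear (e * L / (4 * (t + 1))) (by positivity)
    obtain ⟨k₀, hk₀⟩ := exists_nat_ge ((t : ℝ) / L)
    set k := max (max K k₀) 1
    have hk1 : 0 < (k : ℝ) := Nat.cast_pos.2 (one_pos.trans_le (le_max_right _ _))
    have htk : (t : ℝ) ≤ L * k := by
      rw [div_le_iff₀ hL'] at hk₀
      have : (k₀ : ℝ) ≤ k := Nat.cast_le.2 ((le_max_right _ _).trans (le_max_left _ _))
      nlinarith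
    obtain ⟨I, hI⟩ := hK k ((le_max_left _ _).trans (le_max_left _ _))
    refine ⟨max I k, fun i hi j hj => ?_⟩
    have hi' := hI i ((le_max_left _ _).trans hi)
    have hj' := hI j ((le_max_left _ _).trans hj)
    have h1 := hM.dist_le_of_common_start
      ((hσ i).divides_start t.2 htk (by positivity) (hlarge k i ((le_max_right _ _).trans hi)))
      ((hσ j).divides_start t.2 htk (by positivity) (hlarge k j ((le_max_right _ _).trans hj)))
      (div_nonneg t.2 (by positivity)) (div_le_one_of_le₀ htk (by positivity))
    have h2 := dist_triangle_left (σ i (L * k)) (σ j (L * k)) (x k)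
    calc dist (σ i t) (σ j t) ≤ t / (L * k) * dist (σ i (L * k)) (σ j (L * k)) := h1
      _ ≤ t / (L * k) * (2 * (e * L / (4 * (t + 1)) * k)) := by gcongr; linarith
      _ = e * (t / (2 * (t + 1))) := by field_simp; ring
      _ < e * 1 := by
        gcongr
        rw [div_lt_one (by positivity)]
        linarith [t.2]
      _ = e := mul_one e
  choose c hc using fun t => cauchySeq_tendsto_of_complete (hcauchy t)
  refine ⟨⟨c, Isometry.of_dist_eq fun s t => ?_⟩, ?_⟩
  · refine tendsto_nhds_unique ((hc s).dist (hc t)) (tendsto_const_nhds.congr' ?_)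
    filter_upwards [hevent s, hevent t] with i hs ht
    rw [(hσ i).dist_eq _ hs _ ht, NNReal.dist_eq]
  · rw [Metric.tendsto_atTop]
    intro e he
    obtain ⟨K, hK⟩ := hnear (e / 2) (by positivity)
    refine ⟨max K 1, fun k hk => ?_⟩
    obtain ⟨I, hI⟩ := hK k ((le_max_left _ _).trans hk)
    have hk0 : 0 < (k : ℝ) := Nat.cast_pos.2 ((le_max_right _ _).trans hk)
    have hle : dist (x k) (c (L * k)) ≤ e / 2 * k := by
      refine le_of_tendsto ((tendsto_const_nhds (x := x k)).dist (hc (L * k))) ?_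
      filter_upwards [Filter.eventually_ge_atTop I] with i hi
      simpa using hI i hi
    rw [Real.dist_eq, sub_zero, abs_of_nonneg (by positivity), div_lt_iff₀ hk0]
    nlinarith

end SublinearTracking

/-! ### Translation length and escape rate. -/

section TranslationLength

variable {M : Type u} [MetricSpace M]

theorem translationLength_le (γ : M ≃ᵢ M) (p : M) : translationLength γ ≤ dist (γ p) p :=
  ciInf_le ⟨0, by rintro _ ⟨q, rfl⟩; exact dist_nonneg⟩ p

theorem translationLength_nonneg (γ : M ≃ᵢ M) : 0 ≤ translationLength γ :=
  Real.iInf_nonneg fun _ => dist_nonneg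

theorem isometry_iterate {γ : M → M} (hγ : Isometry γ) (n : ℕ) : Isometry γ^[n] := by
  induction n with
  | zero => exact isometry_id
  | succ n ih => exact ih.comp hγ

theorem dist_iterate_add {γ : M → M} (hγ : Isometry γ) (p : M) (m n : ℕ) :
    dist (γ^[m] p) (γ^[m + n] p) = dist p (γ^[n] p) := by
  rw [Function.iterate_add_apply, (isometry_iterate hγ m).dist_eq]

theorem subadditive_dist_iterate {γ : M → M} (hγ : Isometry γ) (p : M) :
    Subadditive fun n => dist p (γ^[n] p) := fun m n => by
  have := dist_triangle p (γ^[m] p) (γ^[m + n] p)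
  rwa [dist_iterate_add hγ] at this

theorem bddBelow_dist_iterate_div (γ : M → M) (p : M) :
    BddBelow (Set.range fun n : ℕ => dist p (γ^[n] p) / n) :=
  ⟨0, by rintro _ ⟨n, rfl⟩; positivity⟩

/-- If `m` is the midpoint of `p` and `γ p`, then `γ m` is that of `γ p` and `γ (γ p)`; the midline
`m`, `γ m` is at most half the third side. -/
theorem two_mul_le_dist_sq (hM : IsCAT0 M) {γ : M → M} (hγ : Isometry γ) {B : ℝ}
    (hB : ∀ p, B ≤ dist (γ p) p) (p : M) : 2 * B ≤ dist (γ (γ p)) p := by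
  obtain ⟨m, hm, -⟩ := hM.exists_divides p (γ p) (l := 1 / 2) (by norm_num) (by norm_num)
  have h1 := hm.symm
  rw [show (1 : ℝ) - 1 / 2 = 1 / 2 by norm_num] at h1
  have := hM.dist_le_of_common_start h1 (hm.map hγ) (by norm_num) (by norm_num)
  rw [dist_comm m, dist_comm p] at this
  linarith [hB m]

theorem two_pow_mul_le_dist_iterate (hM : IsCAT0 M) {γ : M → M} (hγ : Isometry γ) {B : ℝ}
    (hB : ∀ p, B ≤ dist (γ p) p) (k : ℕ) : ∀ p, 2 ^ k * B ≤ dist (γ^[2 ^ k] p) p := by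
  induction k with
  | zero => simpa using hB
  | succ k ih =>
    intro p
    have := two_mul_le_dist_sq hM (isometry_iterate hγ (2 ^ k)) ih p
    have hk : 2 ^ (k + 1) = 2 ^ k + 2 ^ k := by ring
    rw [hk, Function.iterate_add_apply, pow_succ']
    linarith

/-- The escape rate of an isometry is at least its translation length. -/
theorem le_lim_dist_iterate (hM : IsCAT0 M) {γ : M → M} (hγ : Isometry γ) {B : ℝ}
    (hB : ∀ p, B ≤ dist (γ p) p) (p : M) : B ≤ (subadditive_dist_iterate hγ p).lim := by
  -- The limit exists by subadditivity, so the powers of two suffice to bound it.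
  have hlim := ((subadditive_dist_iterate hγ p).tendsto_lim (bddBelow_dist_iterate_div γ p)).comp
    (tendsto_pow_atTop_atTop_of_one_lt (one_lt_two (α := ℕ)))
  refine ge_of_tendsto' hlim fun k => ?_
  have := two_pow_mul_le_dist_iterate hM hγ hB k p
  simp only [Function.comp_apply, Nat.cast_pow, Nat.cast_ofNat]
  rw [le_div_iff₀ (by positivity), dist_comm]
  linarith

/-- The orbit of `c 0` advances by `n * |τ|` and that of `p` by at most `n * dist (γ p) p`, while
the two stay at constant distance. -/
theorem translationLength_pos_of_isHyperbolic [Nonempty M] {γ : M ≃ᵢ M} (h : IsHyperbolic γ) :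
    0 < translationLength γ := by
  obtain ⟨c, τ, hτ, hc⟩ := h
  refine (abs_pos.2 hτ).trans_le (le_ciInf fun p => ?_)
  have hiter : ∀ n : ℕ, γ^[n] (c.toFun 0) = c.toFun (n * τ) := fun n => by
    induction n with
    | zero => simp
    | succ n ih => rw [Function.iterate_succ_apply', ih, hc]; congr 1; push_cast; ring
  have hle : ∀ n : ℕ, dist p (γ^[n] p) ≤ n * dist (γ p) p := fun n => by
    induction n with
    | zero => simp
    | succ n ih =>
      have h1 := subadditive_dist_iterate γ.isometry p n 1
      simp only [Function.iterate_one] at h1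
      rw [dist_comm (γ p)] at ih ⊢
      push_cast
      linarith
  have hn : ∀ n : ℕ, n * (|τ| - dist (γ p) p) ≤ 2 * dist p (c.toFun 0) := fun n => by
    have h1 := dist_triangle4 (c.toFun 0) p (γ^[n] p) (γ^[n] (c.toFun 0))
    rw [(isometry_iterate γ.isometry n).dist_eq, hiter, c.isometry.dist_eq, Real.dist_eq, zero_sub,
      abs_neg, abs_mul, Nat.abs_cast, dist_comm _ p] at h1
    linarith [hle n]
  by_contra hlt
  push Not at hlt
  obtain ⟨n, hn'⟩ := exists_nat_gt (2 * dist p (c.toFun 0) / (|τ| - dist (γ p) p))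
  rw [div_lt_iff₀ (by linarith)] at hn'
  linarith [hn n]

end TranslationLength

/-! ### Fixed boundary points and the axis. -/

section Axis

variable {M : Type u} [MetricSpace M]

/-- The image of a geodesic ray under an isometric embedding. -/
def GeodesicRay.map {γ : M → M} (hγ : Isometry γ) (c : GeodesicRay M) : GeodesicRay M where
  toFun t := γ (c.toFun t)
  isometry := hγ.comp c.isometry

theorem Asymptotic.map {γ : M → M} (hγ : Isometry γ) {c d : GeodesicRay M} (h : Asymptotic c d) :
    Asymptotic (c.map hγ) (d.map hγ) :=
  h.imp fun _ hK t => (hγ.dist_eq _ _).trans_le (hK t)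

theorem Asymptotic.symm {c d : GeodesicRay M} (h : Asymptotic c d) : Asymptotic d c :=
  (asymptoticSetoid M).symm h

theorem Asymptotic.trans {c d e : GeodesicRay M} (h : Asymptotic c d) (h' : Asymptotic d e) :
    Asymptotic c e :=
  (asymptoticSetoid M).trans h h'

theorem tendsto_const_div_natCast (C : ℝ) :
    Filter.Tendsto (fun k : ℕ => C / k) Filter.atTop (nhds 0) :=
  tendsto_const_nhds.div_atTop tendsto_natCast_atTop_atTop

/-- `γ (c (L k))` is o(k) from the orbit point of index k + 1, which is at constant distance from
that of index k, itself o(k) from `c (L k)`. -/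
theorem asymptotic_map_of_tracking (hM : IsCAT0 M) {γ : M → M} (hγ : Isometry γ) {p : M}
    {c : GeodesicRay M} {L : ℝ≥0} (hL : 0 < L)
    (hc : Filter.Tendsto (fun k : ℕ => dist (γ^[k] p) (c.toFun (L * k)) / k) Filter.atTop
      (nhds 0)) : Asymptotic (c.map hγ) c := by
  refine asymptotic_of_tendsto hM hL ?_
  have hsum := (hc.add (tendsto_const_div_natCast (dist p (γ p)))).add hc
  rw [add_zero, add_zero] at hsum
  refine squeeze_zero (fun k => by positivity) (fun k => ?_) hsum
  rw [← add_div, ← add_div]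
  gcongr
  refine (dist_triangle4 _ (γ (γ^[k] p)) (γ^[k] p) _).trans ?_
  have h1 : dist ((c.map hγ).toFun (L * k)) (γ (γ^[k] p)) = dist (γ^[k] p) (c.toFun (L * k)) := by
    rw [dist_comm]; exact hγ.dist_eq _ _
  have h2 : dist (γ (γ^[k] p)) (γ^[k] p) = dist p (γ p) := by
    rw [dist_comm, ← Function.iterate_succ_apply' γ k p]
    exact dist_iterate_add hγ p k 1
  rw [h1, h2]

theorem isHyperbolic_of_translationLength_pos [CompleteSpace M] [Nonempty M] (hM : IsCAT0 M)
    (hvis : IsSemiUniformlyVisible M) {γ : M ≃ᵢ M} (h : 0 < translationLength γ) :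
    IsHyperbolic γ := by
  obtain ⟨p⟩ := ‹Nonempty M›
  have hγ := γ.isometry
  have hγ' := γ.symm.isometry
  have hsub := subadditive_dist_iterate hγ p
  have hlim := hsub.tendsto_lim (bddBelow_dist_iterate_div γ p)
  have hpos : 0 < hsub.lim :=
    h.trans_le (le_lim_dist_iterate hM hγ (translationLength_le γ) p)
  lift hsub.lim to ℝ≥0 using hpos.le with L hL
  have hL0 : 0 < L := hpos
  have hle : ∀ n : ℕ, L * n ≤ dist p (γ^[n] p) := fun n => by
    rcases Nat.eq_zero_or_pos n with rfl | hn
    · simp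
    · have := hsub.lim_le_div (bddBelow_dist_iterate_div γ p) hn.ne'
      rwa [← hL, le_div_iff₀ (Nat.cast_pos.2 hn)] at this
  have hinv : ∀ k, γ^[k] (γ.symm^[k] p) = p := fun k =>
    Function.RightInverse.iterate γ.apply_symm_apply k p
  have hsymm : ∀ k, dist p (γ.symm^[k] p) = dist p (γ^[k] p) := fun k => by
    rw [← (isometry_iterate hγ k).dist_eq p, hinv, dist_comm]
  obtain ⟨c, hc⟩ := exists_ray_tracking hM hL0 (dist_iterate_add hγ p) hle hlim
  obtain ⟨c', hc'⟩ := exists_ray_tracking hM hL0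
    (fun m n => (dist_iterate_add hγ' p m n).trans (hsymm n)) hle hlim
  have hne : ¬ Asymptotic c' c := by
    rintro ⟨K, hK⟩
    have hsum := (hc'.add (tendsto_const_div_natCast K)).add hc
    rw [add_zero, add_zero] at hsum
    -- Asymptotic rays would make the distance between the forward and backward orbit points o(k),
    -- but it equals `dist p (γ^[k + k] p)`, at least `2 * L * k`.
    have hcontra : 2 * (L : ℝ) ≤ 0 := by
      refine ge_of_tendsto hsum ?_
      filter_upwards [Filter.eventually_gt_atTop 0] with k hk
      rw [← add_div, ← add_div, le_div_iff₀ (Nat.cast_pos.2 hk)]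
      have h1 : dist (γ.symm^[k] p) (γ^[k] p) = dist p (γ^[k + k] p) := by
        rw [← (isometry_iterate hγ k).dist_eq, hinv, ← Function.iterate_add_apply]
      have h2 := dist_triangle4 (γ.symm^[k] p) (c'.toFun (L * k)) (c.toFun (L * k)) (γ^[k] p)
      have h3 := hle (k + k)
      rw [h1, dist_comm _ (γ^[k] p)] at h2
      push_cast at h3
      linarith [hK (L * k)]
    linarith
  obtain ⟨l, hl', hl⟩ := hvis.1 c'.endpoint c.endpoint fun h => hne (Quotient.exact h)
  replace hl' : Asymptotic l.negRay c' := Quotient.exact hl'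
  replace hl : Asymptotic l.posRay c := Quotient.exact hl
  have hfix : Asymptotic (c.map hγ) c := asymptotic_map_of_tracking hM hγ hL0 hc
  have hfix' : Asymptotic (c'.map hγ) c' := by
    obtain ⟨K, hK⟩ := asymptotic_map_of_tracking hM hγ' hL0 hc'
    refine ⟨K, fun t => ?_⟩
    have := hK t
    rw [← hγ.dist_eq, dist_comm] at this
    simpa [GeodesicRay.map] using this
  obtain ⟨K, hK⟩ := ((hl.map hγ).trans hfix).trans hl.symm
  obtain ⟨K', hK'⟩ := ((hl'.map hγ).trans hfix').trans hl'.symm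
  have hpar : Parallel (fun t => γ (l.toFun t)) l.toFun := by
    refine ⟨max K K', fun t => ?_⟩
    rcases le_total 0 t with ht | ht
    · exact (hK ⟨t, ht⟩).trans (le_max_left _ _)
    · have : dist (γ (l.toFun (- -t))) (l.toFun (- -t)) ≤ K' := hK' ⟨-t, by linarith⟩
      rw [neg_neg] at this
      exact this.trans (le_max_right _ _)
  obtain ⟨d, τ, hd, hτ⟩ := exists_invariant_line hM hvis.2 hγ l.isometry hpar
  refine ⟨⟨d, hd⟩, τ, ?_, hτ⟩
  rintro rfl
  have := translationLength_le γ (d 0)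
  rw [hτ, add_zero, dist_self] at this
  linarith

end Axis

end CatZero

theorem theorem1p3 {M : Type u} [MetricSpace M] [CompleteSpace M] [Nonempty M]
    (hM : CatZero.IsCAT0 M) (hvis : CatZero.IsSemiUniformlyVisible M) (γ : M ≃ᵢ M) :
    (CatZero.IsElliptic γ ↔ ∃ p : M, γ p = p) ∧
    (CatZero.IsHyperbolic γ ↔ 0 < CatZero.translationLength γ) ∧
    (CatZero.IsParabolic γ ↔ CatZero.translationLength γ = 0 ∧ ¬ ∃ p : M, γ p = p) := by
  have hyp : CatZero.IsHyperbolic γ ↔ 0 < CatZero.translationLength γ :=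
    ⟨CatZero.translationLength_pos_of_isHyperbolic,
      CatZero.isHyperbolic_of_translationLength_pos hM hvis⟩
  refine ⟨Iff.rfl, hyp, ?_⟩
  rw [CatZero.IsParabolic, hyp, not_lt, and_comm]
  exact and_congr_left' ⟨fun h => le_antisymm h (CatZero.translationLength_nonneg γ), le_of_eq⟩
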